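/- Let $n\ge 0$ be an integer and let $\mathbb R^n$ carry its Euclidean inner product. A set $\Omega\subset\mathbb R^n$ is called nearly convex if there is a convex set $C$ with $C\subset\Omega\subset\overline C$. The relative interior $\mathrm{ri}\,\Omega$ is the interior of $\Omega$ relative to its affine hull. The support function of a nonempty set $\Omega\subset\mathbb R^n$ is $\sigma_\Omega(v)=\sup\{\langle v,x\rangle \mid x\in\Omega\}\in(-\infty,\infty]$ for $v\in\mathbb R^n$. For proper functions $g,h\colon\mathbb R^n\to[-\infty,\infty]$ (never $-\infty$ and not identically $\infty$), the infimal convolution is $(g\,\square\,h)(x)=\inf\{g(x_1)+h(x_2)\mid x_1+x_2=x\}\in[-\infty,\infty]$ for $x\in\mathbb R^n$. **Theorem.** Let $\Omega_1$ and $\Omega_2$ be nearly convex sets in $\mathbb R^n$ such that $\mathrm{ri}\,\Omega_1\cap\mathrm{ri}\,\Omega_2\neq\emptyset$. Then $$\sigma_{\Omega_1\cap\Omega_2}=\sigma_{\Omega_1}\,\square\,\sigma_{\Omega_2}.$$ In addition, for every $v\in\mathbb R^n$ with $\sigma_{\Omega_1\cap\Omega_2}(v)\in\mathbb R$ there exist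 $v_1,v_2\in\mathbb R^n$ such that $v=v_1+v_2$ and $$\sigma_{\Omega_1\cap\Omega_2}(v)=\sigma_{\Omega_1}(v_1)+\sigma_{\Omega_2}(v_2).$$ -/

import Mathlib

/-- A set is nearly convex if it lies between a convex set and the closure of that convex set. -/
def NearlyConvex {n : ℕ} (Ω : Set (EuclideanSpace ℝ (Fin n))) : Prop :=
  ∃ C : Set (EuclideanSpace ℝ (Fin n)), Convex ℝ C ∧ C ⊆ Ω ∧ Ω ⊆ closure C

/-- The support function `v ↦ sup {⟪v, x⟫ | x ∈ Ω}`, with values in `[-∞, ∞]`. -/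
noncomputable def supportFunction {n : ℕ} (Ω : Set (EuclideanSpace ℝ (Fin n)))
    (v : EuclideanSpace ℝ (Fin n)) : EReal :=
  ⨆ x ∈ Ω, ((inner ℝ v x : ℝ) : EReal)

/-- The infimal convolution `x ↦ inf {g x₁ + h x₂ | x₁ + x₂ = x}`. It is meant for functions
that never take the value `-∞`, so that the sums are unambiguous. -/
noncomputable def infimalConvolution {n : ℕ} (g h : EuclideanSpace ℝ (Fin n) → EReal)
    (x : EuclideanSpace ℝ (Fin n)) : EReal :=
  sInf {r : EReal | ∃ x₁ x₂ : EuclideanSpace ℝ (Fin n), x₁ + x₂ = x ∧ r = g x₁ + h x₂}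

open Filter Topology Pointwise

/-! One inequality is additivity of the inner product. For the other, let `f = ⟪v, ·⟫` be at most
`r` on `C₁ ∩ C₂`. The cone generated by the points `(x - y, s)` with `x ∈ C₁`, `y ∈ C₂`, `s ≥ r - f
x` meets the vertical axis only in nonnegative heights, so M. Riesz extension gives a positive
functional equal to the height on that axis. Its horizontal part `g` satisfies `g (x - y) + r - f x
≥ 0`, which is the splitting `f = (f - g) + g`. A common relative interior point makes the extension
possible; continuity then carries the bound from `Cᵢ` to `Ωᵢ ⊆ closure Cᵢ`. -/

/-- Algebraic Fenchel duality: a linear functional bounded by `r` on the intersection of two convex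
sets splits into two functionals whose suprema over the individual sets add up to at most `r`,
provided some point lies in the relative algebraic interior of both sets. -/
theorem Convex.exists_linearMap_le_of_forall_inter_le {E : Type*} [AddCommGroup E] [Module ℝ E]
    {C₁ C₂ : Set E} (hC₁ : Convex ℝ C₁) (hC₂ : Convex ℝ C₂) {x₀ : E}
    (h₁ : x₀ ∈ C₁) (h₂ : x₀ ∈ C₂)
    (hcore₁ : ∀ y ∈ C₁, ∀ᶠ ε : ℝ in 𝓝[>] 0, x₀ + ε • (x₀ - y) ∈ C₁)
    (hcore₂ : ∀ y ∈ C₂, ∀ᶠ ε : ℝ in 𝓝[>] 0, x₀ + ε • (x₀ - y) ∈ C₂)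
    (f : E →ₗ[ℝ] ℝ) {r : ℝ} (hf : ∀ x ∈ C₁ ∩ C₂, f x ≤ r) :
    ∃ g : E →ₗ[ℝ] ℝ, ∀ x ∈ C₁, ∀ y ∈ C₂, (f - g) x + g y ≤ r := by
  set L : Submodule ℝ E := Submodule.span ℝ (C₁ - C₂)
  have hrep : ∀ u ∈ L, ∃ t : ℝ, 0 ≤ t ∧ ∃ a ∈ t • C₁, ∃ b ∈ t • C₂, u = a - b := by
    intro u hu
    induction hu using Submodule.span_induction with
    | mem u hu =>
      obtain ⟨a, ha, b, hb, rfl⟩ := hu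
      exact ⟨1, zero_le_one, a, by simpa using ha, b, by simpa using hb, rfl⟩
    | zero => exact ⟨1, zero_le_one, x₀, by simpa using h₁, x₀, by simpa using h₂, by simp⟩
    | add u w _ _ ihu ihw =>
      obtain ⟨t, ht, a, ha, b, hb, rfl⟩ := ihu
      obtain ⟨s, hs, c, hc, d, hd, rfl⟩ := ihw
      refine ⟨t + s, add_nonneg ht hs, a + c, ?_, b + d, ?_, by abel⟩
      · rw [hC₁.add_smul ht hs]
        exact Set.add_mem_add ha hc
      · rw [hC₂.add_smul ht hs]
        exact Set.add_mem_add hb hd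
    | smul c u _ ih =>
      obtain ⟨t, ht, _, ⟨x, hx, rfl⟩, _, ⟨y, hy, rfl⟩, rfl⟩ := ih
      rcases le_or_gt 0 c with hc | hc
      · refine ⟨c * t, mul_nonneg hc ht, (c * t) • x, Set.smul_mem_smul_set hx,
          (c * t) • y, Set.smul_mem_smul_set hy, ?_⟩
        simp only [smul_sub, mul_smul]
      -- Reflecting `x` and `y` through `x₀` reverses their difference: the new points differ by `-ε
      -- • (x - y)`.
      · obtain ⟨ε, ⟨hx', hy'⟩, hε⟩ :=
          (((hcore₁ x hx).and (hcore₂ y hy)).and self_mem_nhdsWithin).exists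
        have hε : 0 < ε := hε
        refine ⟨-c * t / ε, by have := mul_nonneg (neg_nonneg.2 hc.le) ht; positivity, _,
          Set.smul_mem_smul_set hx', _, Set.smul_mem_smul_set hy', ?_⟩
        match_scalars <;> field_simp
        ring
  let K : PointedCone ℝ (L × ℝ) :=
    { carrier := {p | ∃ t : ℝ, 0 ≤ t ∧ ∃ a ∈ t • C₁, ∃ b ∈ t • C₂,
        (p.1 : E) = a - b ∧ t * r - f a ≤ p.2}
      add_mem' := by
        rintro p q ⟨t, ht, a, ha, b, hb, hp, hp'⟩ ⟨s, hs, c, hc, d, hd, hq, hq'⟩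
        refine ⟨t + s, add_nonneg ht hs, a + c, ?_, b + d, ?_, ?_, ?_⟩
        · rw [hC₁.add_smul ht hs]
          exact Set.add_mem_add ha hc
        · rw [hC₂.add_smul ht hs]
          exact Set.add_mem_add hb hd
        · simp only [Prod.fst_add, Submodule.coe_add, hp, hq]
          abel
        · simp only [map_add, Prod.snd_add]
          linarith
      zero_mem' := ⟨0, le_rfl, 0, ⟨x₀, h₁, zero_smul _ _⟩, 0, ⟨x₀, h₂, zero_smul _ _⟩, by simp,
        by simp⟩
      smul_mem' := by
        rintro ⟨c, hc⟩ p ⟨t, ht, _, ⟨x, hx, rfl⟩, _, ⟨y, hy, rfl⟩, hp, hp'⟩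
        refine ⟨c * t, mul_nonneg hc ht, (c * t) • x, Set.smul_mem_smul_set hx,
          (c * t) • y, Set.smul_mem_smul_set hy, ?_, ?_⟩
        · change c • (p.1 : E) = _
          rw [hp]
          simp only [smul_sub, mul_smul]
        · change _ ≤ c * p.2
          simp only [map_smul, smul_eq_mul] at hp' ⊢
          nlinarith [mul_le_mul_of_nonneg_left hp' hc] }
  let φ : (L × ℝ) →ₗ.[ℝ] ℝ :=
    { domain := (⊥ : Submodule ℝ L).prod ⊤
      toFun := (LinearMap.snd ℝ L ℝ).comp (Submodule.subtype _) }
  obtain ⟨G, hGφ, hGK⟩ := riesz_extension K φ (by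
      rintro ⟨⟨u, s⟩, (hu : u = 0), _⟩ ⟨t, ht, _, ⟨x, hx, rfl⟩, _, ⟨y, hy, rfl⟩, hp, hp'⟩
      have hxy0 : t • x = t • y := sub_eq_zero.1 (hp.symm.trans (congrArg Subtype.val hu))
      rw [map_smul, smul_eq_mul] at hp'
      refine le_trans ?_ hp'
      rcases ht.eq_or_lt with rfl | ht
      · simp
      · have hxy : x = y := smul_right_injective E ht.ne' hxy0
        have := hf x ⟨hx, hxy ▸ hy⟩
        nlinarith) (by
      rintro ⟨u, s⟩
      obtain ⟨t, ht, a, ha, b, hb, hu⟩ := hrep u u.2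
      exact ⟨⟨(0, t * r - f a - s), by simp [φ]⟩, t, ht, a, ha, b, hb, by simpa using hu,
        by simp⟩)
  obtain ⟨g, hg⟩ := (G.comp (LinearMap.inl ℝ L ℝ)).exists_extend
  refine ⟨g, fun x hx y hy => ?_⟩
  have hmem : x - y ∈ L := Submodule.subset_span (Set.sub_mem_sub hx hy)
  have h := hGK (⟨x - y, hmem⟩, r - f x)
    ⟨1, zero_le_one, x, by simpa using hx, y, by simpa using hy, rfl, by simp⟩
  have hsplit : ((⟨x - y, hmem⟩ : L), r - f x) =
      LinearMap.inl ℝ L ℝ ⟨x - y, hmem⟩ + ((0 : L), r - f x) := by simp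
  have hg' : g (x - y) = G (LinearMap.inl ℝ L ℝ ⟨x - y, hmem⟩) :=
    LinearMap.congr_fun hg ⟨x - y, hmem⟩
  have hG0 : G ((0 : L), r - f x) = r - f x := hGφ ⟨((0 : L), r - f x), by simp [φ]⟩
  rw [hsplit, map_add, ← hg', hG0, map_sub] at h
  simp only [LinearMap.sub_apply]
  linarith

section RelativeInterior

variable {E : Type*} [NormedAddCommGroup E] [NormedSpace ℝ E] {s C : Set E} {x z w : E}

theorem eventually_mem_of_mem_intrinsicInterior (hx : x ∈ intrinsicInterior ℝ s) :
    ∀ᶠ y in 𝓝 x, y ∈ affineSpan ℝ s → y ∈ s := by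
  obtain ⟨y, hy, rfl⟩ := mem_intrinsicInterior.1 hx
  obtain ⟨u, hu, hus⟩ := (mem_nhds_subtype _ _ _).1 (mem_interior_iff_mem_nhds.1 hy)
  exact Filter.mem_of_superset hu fun p hp hps => hus (a := ⟨p, hps⟩) hp

/-- An open segment from a relative interior point to a closure point of a convex set lies in the
set. -/
theorem Convex.mem_of_intrinsicInterior_of_closure [FiniteDimensional ℝ E] (hC : Convex ℝ C)
    (hz : z ∈ intrinsicInterior ℝ C) (hw : w ∈ closure C) {ε : ℝ} (hε : 0 < ε) {p : E}
    (hp : (1 + ε) • p = w + ε • z) : p ∈ C := by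
  have hzA : z ∈ affineSpan ℝ C := subset_affineSpan ℝ C (intrinsicInterior_subset hz)
  have hclosed : IsClosed (affineSpan ℝ C : Set E) := AffineSubspace.closed_of_finiteDimensional _
  have hwA : w ∈ affineSpan ℝ C := closure_minimal (subset_affineSpan ℝ C) hclosed hw
  -- Replace `w` by a nearby `w' ∈ C` and move `z` to compensate, so that `w' + ε • z'` still equals
  -- `(1 + ε) • p`.
  have hcont : Tendsto (fun w' : E => ε⁻¹ • (w - w') + z) (𝓝 w) (𝓝 z) := by
    have : Continuous fun w' : E => ε⁻¹ • (w - w') + z := by fun_prop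
    simpa using this.tendsto w
  obtain ⟨w', hw', hw'C⟩ := ((hcont.eventually
    (eventually_mem_of_mem_intrinsicInterior hz)).and_frequently
      (mem_closure_iff_frequently.1 hw)).exists
  have hz' : ε⁻¹ • (w - w') + z ∈ C := hw'
    (AffineSubspace.smul_vsub_vadd_mem _ ε⁻¹ hwA (subset_affineSpan ℝ C hw'C) hzA)
  have hmem := hC hw'C hz' (a := (1 + ε)⁻¹) (b := ε * (1 + ε)⁻¹) (by positivity) (by positivity)
    (by field_simp)
  have hp' : p = (1 + ε)⁻¹ • (w + ε • z) := by
    rw [← hp, smul_smul, inv_mul_cancel₀ (by positivity), one_smul]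
  convert hmem using 1
  rw [hp']
  match_scalars <;> field_simp
  ring

/-- A relative interior point of a set lying between a convex set and its closure belongs to the
relative algebraic interior of the convex set. -/
theorem Convex.eventually_mem_of_mem_intrinsicInterior_of_subset_closure [FiniteDimensional ℝ E]
    (hC : Convex ℝ C) (hCs : C ⊆ s) (hsC : s ⊆ closure C) (hx : x ∈ intrinsicInterior ℝ s) {y : E}
    (hy : y ∈ affineSpan ℝ s) : ∀ᶠ ε : ℝ in 𝓝[>] 0, x + ε • (x - y) ∈ C := by
  have hxs := intrinsicInterior_subset hx
  have hxA : x ∈ affineSpan ℝ s := subset_affineSpan ℝ s hxs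
  obtain ⟨z, hz⟩ := (closure_nonempty_iff.1 ⟨x, hsC hxs⟩ : C.Nonempty).intrinsicInterior hC
  have hzA : z ∈ affineSpan ℝ s := subset_affineSpan ℝ s (hCs (intrinsicInterior_subset hz))
  -- With `q = x + ε • (x - y)`, the point `q + ε • (q - z)` beyond `q` is still in `s`, hence in
  -- `closure C`; so `q` lies strictly between it and `z`.
  have hcont : Tendsto (fun ε : ℝ => ε • ((x + ε • (x - y)) - z) + (x + ε • (x - y))) (𝓝 0)
      (𝓝 x) := by
    have : Continuous fun ε : ℝ => ε • ((x + ε • (x - y)) - z) + (x + ε • (x - y)) := by fun_prop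
    simpa using this.tendsto 0
  filter_upwards [nhdsWithin_le_nhds
    (hcont.eventually (eventually_mem_of_mem_intrinsicInterior hx)), self_mem_nhdsWithin] with ε h hε
  have hqA : x + ε • (x - y) ∈ affineSpan ℝ s := by
    simpa [add_comm] using AffineSubspace.smul_vsub_vadd_mem _ ε hxA hy hxA
  refine hC.mem_of_intrinsicInterior_of_closure hz
    (hsC (h (AffineSubspace.smul_vsub_vadd_mem _ ε hqA hzA hqA))) hε ?_
  module

theorem Convex.mem_of_mem_intrinsicInterior_of_subset_closure [FiniteDimensional ℝ E]
    (hC : Convex ℝ C) (hCs : C ⊆ s) (hsC : s ⊆ closure C) (hx : x ∈ intrinsicInterior ℝ s) :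
    x ∈ C := by
  obtain ⟨ε, hε⟩ := (hC.eventually_mem_of_mem_intrinsicInterior_of_subset_closure hCs hsC hx
    (subset_affineSpan ℝ s (intrinsicInterior_subset hx))).exists
  simpa using hε

end RelativeInterior

section SupportFunction

variable {n : ℕ} {Ω Ω₁ Ω₂ : Set (EuclideanSpace ℝ (Fin n))} {v v₁ v₂ : EuclideanSpace ℝ (Fin n)}

theorem le_supportFunction {x : EuclideanSpace ℝ (Fin n)} (hx : x ∈ Ω) :
    ((inner ℝ v x : ℝ) : EReal) ≤ supportFunction Ω v :=
  le_iSup₂_of_le x hx le_rfl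

theorem supportFunction_le_coe_iff {r : ℝ} :
    supportFunction Ω v ≤ r ↔ ∀ x ∈ Ω, inner ℝ v x ≤ r := by
  simp [supportFunction]

theorem supportFunction_inter_add_le :
    supportFunction (Ω₁ ∩ Ω₂) (v₁ + v₂) ≤ supportFunction Ω₁ v₁ + supportFunction Ω₂ v₂ :=
  iSup₂_le fun x hx => by
    rw [inner_add_left, EReal.coe_add]
    exact add_le_add (le_supportFunction hx.1) (le_supportFunction hx.2)

theorem supportFunction_add_le_of_forall (h₁ : Ω₁.Nonempty) (h₂ : Ω₂.Nonempty) {r : ℝ}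
    (h : ∀ x ∈ Ω₁, ∀ y ∈ Ω₂, inner ℝ v₁ x + inner ℝ v₂ y ≤ r) :
    supportFunction Ω₁ v₁ + supportFunction Ω₂ v₂ ≤ r := by
  obtain ⟨x, hx⟩ := h₁
  obtain ⟨y, hy⟩ := h₂
  have key : ∀ y ∈ Ω₂, supportFunction Ω₁ v₁ ≤ ((r - inner ℝ v₂ y : ℝ) : EReal) := fun y hy =>
    supportFunction_le_coe_iff.2 fun x hx => by linarith [h x hx y hy]
  -- Both sets being nonempty makes this supremum finite, so it can be subtracted from `r`.
  obtain ⟨s, hs⟩ : ∃ s : ℝ, (s : EReal) = supportFunction Ω₁ v₁ :=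
    ⟨_, EReal.coe_toReal ((key y hy).trans_lt (EReal.coe_lt_top _)).ne
      ((EReal.bot_lt_coe _).trans_le (le_supportFunction hx)).ne'⟩
  rw [← hs] at key ⊢
  have hs₂ : supportFunction Ω₂ v₂ ≤ ((r - s : ℝ) : EReal) :=
    supportFunction_le_coe_iff.2 fun y hy => by linarith [EReal.coe_le_coe_iff.1 (key y hy)]
  calc (s : EReal) + supportFunction Ω₂ v₂ ≤ (s : EReal) + ((r - s : ℝ) : EReal) := by gcongr
    _ = r := by rw [← EReal.coe_add, add_sub_cancel]

theorem NearlyConvex.exists_add_supportFunction_le (h₁ : NearlyConvex Ω₁) (h₂ : NearlyConvex Ω₂)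
    (hri : (intrinsicInterior ℝ Ω₁ ∩ intrinsicInterior ℝ Ω₂).Nonempty) {r : ℝ}
    (hr : supportFunction (Ω₁ ∩ Ω₂) v ≤ r) :
    ∃ v₁ v₂, v = v₁ + v₂ ∧ supportFunction Ω₁ v₁ + supportFunction Ω₂ v₂ ≤ r := by
  obtain ⟨C₁, hC₁, hCΩ₁, hΩC₁⟩ := h₁
  obtain ⟨C₂, hC₂, hCΩ₂, hΩC₂⟩ := h₂
  obtain ⟨x₀, hx₁, hx₂⟩ := hri
  obtain ⟨g, hg⟩ := hC₁.exists_linearMap_le_of_forall_inter_le hC₂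
    (hC₁.mem_of_mem_intrinsicInterior_of_subset_closure hCΩ₁ hΩC₁ hx₁)
    (hC₂.mem_of_mem_intrinsicInterior_of_subset_closure hCΩ₂ hΩC₂ hx₂)
    (fun y hy => hC₁.eventually_mem_of_mem_intrinsicInterior_of_subset_closure hCΩ₁ hΩC₁ hx₁
      (subset_affineSpan ℝ _ (hCΩ₁ hy)))
    (fun y hy => hC₂.eventually_mem_of_mem_intrinsicInterior_of_subset_closure hCΩ₂ hΩC₂ hx₂
      (subset_affineSpan ℝ _ (hCΩ₂ hy)))
    (innerSL ℝ v).toLinearMap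
    (fun x hx => supportFunction_le_coe_iff.1 hr x ⟨hCΩ₁ hx.1, hCΩ₂ hx.2⟩)
  set w := (InnerProductSpace.toDual ℝ (EuclideanSpace ℝ (Fin n))).symm
    (LinearMap.toContinuousLinearMap g)
  have hw : ∀ x, inner ℝ w x = g x := fun x => by simp [w]
  refine ⟨v - w, w, (sub_add_cancel v w).symm, supportFunction_add_le_of_forall
    ⟨x₀, intrinsicInterior_subset hx₁⟩ ⟨x₀, intrinsicInterior_subset hx₂⟩ fun x hx y hy => ?_⟩
  -- The joint bound is a closed condition on pairs, so it passes to the closures.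
  have hsub : closure (C₁ ×ˢ C₂) ⊆ {p : EuclideanSpace ℝ (Fin n) × EuclideanSpace ℝ (Fin n) |
      inner ℝ (v - w) p.1 + inner ℝ w p.2 ≤ r} :=
    closure_minimal (fun p hp => by simpa [inner_sub_left, hw] using hg p.1 hp.1 p.2 hp.2)
      (isClosed_le (by fun_prop) continuous_const)
  rw [closure_prod_eq] at hsub
  exact hsub (show (x, y) ∈ closure C₁ ×ˢ closure C₂ from ⟨hΩC₁ hx, hΩC₂ hy⟩)

end SupportFunction

theorem theorem6p1 {n : ℕ} (Ω₁ Ω₂ : Set (EuclideanSpace ℝ (Fin n)))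
    (h₁ : NearlyConvex Ω₁) (h₂ : NearlyConvex Ω₂)
    (hri : (intrinsicInterior ℝ Ω₁ ∩ intrinsicInterior ℝ Ω₂).Nonempty) :
    supportFunction (Ω₁ ∩ Ω₂) =
        infimalConvolution (supportFunction Ω₁) (supportFunction Ω₂) ∧
      ∀ v : EuclideanSpace ℝ (Fin n),
        (∃ r : ℝ, supportFunction (Ω₁ ∩ Ω₂) v = (r : EReal)) →
          ∃ v₁ v₂ : EuclideanSpace ℝ (Fin n), v = v₁ + v₂ ∧
            supportFunction (Ω₁ ∩ Ω₂) v = supportFunction Ω₁ v₁ + supportFunction Ω₂ v₂ := by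
  have attained : ∀ v : EuclideanSpace ℝ (Fin n),
      (∃ r : ℝ, supportFunction (Ω₁ ∩ Ω₂) v = (r : EReal)) →
        ∃ v₁ v₂ : EuclideanSpace ℝ (Fin n), v = v₁ + v₂ ∧
          supportFunction (Ω₁ ∩ Ω₂) v = supportFunction Ω₁ v₁ + supportFunction Ω₂ v₂ := by
    rintro v ⟨r, hr⟩
    obtain ⟨v₁, v₂, rfl, hle⟩ := h₁.exists_add_supportFunction_le h₂ hri hr.le
    exact ⟨v₁, v₂, rfl, le_antisymm supportFunction_inter_add_le (hr ▸ hle)⟩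
  refine ⟨funext fun v => le_antisymm (le_sInf ?_) ?_, attained⟩
  · rintro _ ⟨v₁, v₂, rfl, rfl⟩
    exact supportFunction_inter_add_le
  · obtain ⟨x₀, hx₁, hx₂⟩ := hri
    have hx₀ : x₀ ∈ Ω₁ ∩ Ω₂ := ⟨intrinsicInterior_subset hx₁, intrinsicInterior_subset hx₂⟩
    have hbot : supportFunction (Ω₁ ∩ Ω₂) v ≠ ⊥ :=
      ((EReal.bot_lt_coe _).trans_le (le_supportFunction hx₀)).ne'
    rcases eq_or_ne (supportFunction (Ω₁ ∩ Ω₂) v) ⊤ with htop | htop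
    · exact htop ▸ le_top
    · obtain ⟨v₁, v₂, hv, hσ⟩ := attained v ⟨_, (EReal.coe_toReal htop hbot).symm⟩
      have hmem : ∃ x₁ x₂, x₁ + x₂ = v ∧ supportFunction (Ω₁ ∩ Ω₂) v =
          supportFunction Ω₁ x₁ + supportFunction Ω₂ x₂ := ⟨v₁, v₂, hv.symm, hσ⟩
      exact sInf_le hmem
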